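/- A parity game consists of a finite directed graph $(V,E)$ in which every node has at least one outgoing edge, a starting node $s\in V$, and a priority $\mathrm{val}(v)\in\{1,\dots,m\}$ for every $v\in V$. Two players, Anke and Boris, move alternately along edges, Anke first, producing an infinite play $v_0=s,v_1,v_2,\dots$; Anke wins the play iff $\limsup_t \mathrm{val}(v_t)$ is even. Anke wins the parity game if she has a strategy (depending on the nodes visited so far) such that she wins every play consistent with it. Let $k$ be an integer with $2^k>2|V|$. A statistic is a partial function $f:\{0,\dots,k\}\rightharpoonup\{1,\dots,m\}$ that is increasing in the weak sense: $f(i)\le f(j)$ for all $i\le j$ in $\mathrm{dom}(f)$. Inserting $c$ at index $\ell$ removes all pairs of index $\le \ell$ from $f$ and adds the pair $(\ell,c)$. The update of a statistic $f$ by a priority $c$ is obtained by applying successively two rules. (I) If $c$ is even, insert $c$ at the highest index $j\in\{0,\dots,k\}$ such that $f$ is defined and even on $0,\dots,j-1$. (II) If the resulting partial function has a value $<c$, insert $c$ at its highest index whose value is $<c$. Along a play $v_0,v_1,\dots$ the statistics are $f_0=\emptyset$ and $f_{t+1}=$ the update of $f_t$ by $\mathrm{val}(v_t)$. Anke wins the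 statistics game if she has a strategy such that every play consistent with it visits a statistic $f_t$ with $k\in\mathrm{dom}(f_t)$. Theorem. For every parity game and every integer $k$ with $2^k>2|V|$, Anke wins the parity game if and only if she wins the statistics game. -/

import Mathlib

/-- A parity game on the set `V` of nodes: a directed graph in which every node has at least one
outgoing edge, a starting node, and a priority in `{1, …, m}` for every node. -/
structure ParityGame (V : Type*) where
  /-- the edge relation: `Edge v w` means that the move from `v` to `w` is valid -/
  Edge : V → V → Prop
  /-- the starting node -/
  start : V
  /-- the number of available priorities -/
  m : ℕ
  /-- the priority of a node -/
  val : V → ℕ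
  val_mem : ∀ v, val v ∈ Set.Icc 1 m
  exists_edge : ∀ v, ∃ w, Edge v w

namespace ParityGame

variable {V : Type*}

/-- A play: an infinite path in the graph from the starting node. The move at the node `v t` is
made by Anke if `t` is even and by Boris if `t` is odd. -/
def IsPlay (G : ParityGame V) (v : ℕ → V) : Prop :=
  v 0 = G.start ∧ ∀ t, G.Edge (v t) (v (t + 1))

/-- A strategy: from the list of nodes visited before the current one, and the current node, it
chooses a valid move. -/
structure Strategy (G : ParityGame V) where
  next : List V → V → V
  valid : ∀ h v, G.Edge v (next h v)

/-- Anke follows the strategy `σ` in `v`: all moves at even times are those chosen by `σ`. -/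
def AnkeFollows (G : ParityGame V) (σ : G.Strategy) (v : ℕ → V) : Prop :=
  ∀ t, Even t → v (t + 1) = σ.next ((List.range t).map v) (v t)

/-- The play `v` is won by Anke: the limit superior of the visited priorities is even. -/
def AnkeWinsPlay (G : ParityGame V) (v : ℕ → V) : Prop :=
  Even (Filter.limsup (fun t => G.val (v t)) Filter.atTop)

/-- Anke wins the parity game: she has a strategy that guarantees that the play is won by her. -/
def AnkeWinsParityGame (G : ParityGame V) : Prop :=
  ∃ σ : G.Strategy, ∀ v : ℕ → V, G.IsPlay v → G.AnkeFollows σ v → G.AnkeWinsPlay v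

end ParityGame

/-- Partial functions from `{0, …, k}` to the natural numbers. -/
abbrev PriorityMap (k : ℕ) := Fin (k + 1) → Option ℕ

namespace PriorityMap

/-- Insert `c` at the index `l`: all pairs of index `≤ l` are removed and `(l, c)` is added. -/
def insertAt {k : ℕ} (f : PriorityMap k) (l : Fin (k + 1)) (c : ℕ) : PriorityMap k :=
  fun i => if i < l then none else if i = l then some c else f i

/-- The indices `j` such that `f` is defined and even on `0, …, j - 1`. -/
def evenBelow {k : ℕ} (f : PriorityMap k) : Finset (Fin (k + 1)) :=
  Finset.univ.filter fun j => ∀ i < j, ∃ d ∈ f i, Even d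

theorem evenBelow_nonempty {k : ℕ} (f : PriorityMap k) : f.evenBelow.Nonempty :=
  ⟨0, by simp [evenBelow]⟩

/-- The indices at which `f` is defined with a value `< c`. -/
def below {k : ℕ} (f : PriorityMap k) (c : ℕ) : Finset (Fin (k + 1)) :=
  Finset.univ.filter fun j => ∃ d ∈ f j, d < c

/-- Type I rule: an even `c` is inserted at the highest index `j` such that `f` is defined and
even on `0, …, j - 1`. -/
def ruleI {k : ℕ} (f : PriorityMap k) (c : ℕ) : PriorityMap k :=
  if Even c then f.insertAt (f.evenBelow.max' f.evenBelow_nonempty) c else f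

/-- Type II rule: if `f` has a value `< c`, then `c` is inserted at the highest index `j` such
that `f j < c`. -/
def ruleII {k : ℕ} (f : PriorityMap k) (c : ℕ) : PriorityMap k :=
  if h : (f.below c).Nonempty then f.insertAt ((f.below c).max' h) c else f

/-- The update by `c`: the type I rule, followed by the type II rule. -/
def update {k : ℕ} (f : PriorityMap k) (c : ℕ) : PriorityMap k :=
  (f.ruleI c).ruleII c

/-- `f` takes values in `{1, …, m}` and is increasing (in the weak sense) on its domain. -/
def IsStatistic {k : ℕ} (m : ℕ) (f : PriorityMap k) : Prop :=
  (∀ i, ∀ a ∈ f i, a ∈ Set.Icc 1 m) ∧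
    ∀ i j, i ≤ j → ∀ a ∈ f i, ∀ b ∈ f j, a ≤ b

theorem insertAt_mem {k : ℕ} {f : PriorityMap k} {l i : Fin (k + 1)} {c a : ℕ}
    (h : a ∈ f.insertAt l c i) : (i = l ∧ a = c) ∨ (l < i ∧ a ∈ f i) := by
  unfold insertAt at h
  split_ifs at h with h1 h2
  · simp at h
  · left
    exact ⟨h2, by simpa using h.symm⟩
  · exact Or.inr ⟨lt_of_le_of_ne (not_lt.mp h1) (Ne.symm h2), h⟩

/-- The update of a statistic is a statistic. -/
theorem IsStatistic.update {k m : ℕ} {f : PriorityMap k} (hf : f.IsStatistic m) {c : ℕ}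
    (hc : c ∈ Set.Icc 1 m) : (f.update c).IsStatistic m := by
  obtain ⟨hr, hi⟩ := hf
  have key : ∀ l : Fin (k + 1), (∀ i, l < i → ∀ b ∈ f i, c ≤ b) →
      (f.insertAt l c).IsStatistic m := by
    intro l hl
    refine ⟨fun i a ha => ?_, fun i j hij a ha b hb => ?_⟩
    · rcases insertAt_mem ha with ⟨-, rfl⟩ | ⟨-, h⟩
      · exact hc
      · exact hr i a h
    · rcases insertAt_mem ha with ⟨rfl, rfl⟩ | ⟨h, h'⟩ <;>
        rcases insertAt_mem hb with ⟨rfl, rfl⟩ | ⟨g, g'⟩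
      · exact le_rfl
      · exact hl j g b g'
      · exact absurd (lt_of_lt_of_le h hij) (lt_irrefl _)
      · exact hi i j hij a h' b g'
  have top : ∀ (g : PriorityMap k) (h : (g.below c).Nonempty), ∀ i,
      (g.below c).max' h < i → ∀ b ∈ g i, c ≤ b := by
    intro g h i hlt b hb
    by_contra hcon
    have hmem : i ∈ g.below c := by
      simp only [below, Finset.mem_filter, Finset.mem_univ, true_and]
      exact ⟨b, hb, not_le.mp hcon⟩
    exact absurd (Finset.le_max' _ _ hmem) (not_le.mpr hlt)
  unfold PriorityMap.update ruleI
  split_ifs with he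
  · generalize f.evenBelow.max' f.evenBelow_nonempty = l
    unfold ruleII
    split_ifs with h
    · have hmax := Finset.max'_mem _ h
      have htop := top _ h
      generalize ((f.insertAt l c).below c).max' h = p at hmax htop
      simp only [below, Finset.mem_filter, Finset.mem_univ, true_and] at hmax
      obtain ⟨d, hd, hdc⟩ := hmax
      have hlp : l < p := by
        rcases insertAt_mem hd with ⟨-, rfl⟩ | ⟨h, -⟩
        · exact absurd hdc (lt_irrefl _)
        · exact h
      have e : (f.insertAt l c).insertAt p c = f.insertAt p c := by
        funext i
        unfold insertAt
        split_ifs with h1 h2 h3 h4 <;> first | rfl | (exfalso; omega)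
      rw [e]
      refine key p fun i hpi b hb => htop i hpi b ?_
      have hli := hlp.trans hpi
      unfold insertAt
      rw [if_neg (not_lt.mpr hli.le), if_neg hli.ne']
      exact hb
    · refine key l fun i hli b hb => ?_
      by_contra hcon
      refine h ⟨i, ?_⟩
      simp only [below, Finset.mem_filter, Finset.mem_univ, true_and]
      refine ⟨b, ?_, not_le.mp hcon⟩
      unfold insertAt
      rw [if_neg (not_lt.mpr hli.le), if_neg hli.ne']
      exact hb
  · unfold ruleII
    split_ifs with h
    · exact key _ (top f h)
    · exact ⟨hr, hi⟩

end PriorityMap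

/-- Statistics: increasing partial functions from `{0, …, k}` to `{1, …, m}`. -/
def Statistic (k m : ℕ) : Type := {f : PriorityMap k // f.IsStatistic m}

namespace Statistic

/-- The empty statistic. -/
def empty (k m : ℕ) : Statistic k m := ⟨fun _ => none, by simp [PriorityMap.IsStatistic]⟩

/-- The update of a statistic by a priority. -/
def update {k m : ℕ} (f : Statistic k m) (c : ℕ) (hc : c ∈ Set.Icc 1 m) : Statistic k m :=
  ⟨f.1.update c, f.2.update hc⟩

/-- The domain of a statistic. -/
def dom {k m : ℕ} (f : Statistic k m) : Set (Fin (k + 1)) := {i | (f.1 i).isSome}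

end Statistic

namespace ParityGame

variable {V : Type*}

/-- The sequence of statistics along `v`: it starts with the empty statistic, which is updated
successively by the priorities of `v 0`, `v 1`, …. -/
def statistic (G : ParityGame V) (k : ℕ) (v : ℕ → V) : ℕ → Statistic k G.m
  | 0 => Statistic.empty k G.m
  | t + 1 => (G.statistic k v t).update (G.val (v t)) (G.val_mem (v t))

/-- Anke wins the statistics game with indices `{0, …, k}`: she has a strategy that enforces a
visit to a statistic whose domain contains `k`. -/
def AnkeWinsStatisticsGame (G : ParityGame V) (k : ℕ) : Prop :=
  ∃ σ : G.Strategy, ∀ v : ℕ → V, G.IsPlay v → G.AnkeFollows σ v →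
    ∃ t, Fin.last k ∈ (G.statistic k v t).dom

end ParityGame

/-!
Both directions relate the play-by-play behaviour of the statistics to the parity condition.

If Anke wins the parity game, the same strategy wins the statistics game, because *every* play
whose limit superior `C` is even reaches a statistic that is defined at `k`. Once all priorities
are `≤ C`, a statistic works as a counter: give the index `i` the digit `2` if the value there is
even and `≥ C`, the digit `1` if it is the topmost value `< C`, and `0` otherwise
(`PriorityMap.digit`). While `k` is not reached, no update decreases this number, and each visit
to `C` increases it (`PriorityMap.digits_le_update`, `PriorityMap.digits_lt_update_self`). There
are only finitely many numbers of this kind.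

Conversely, suppose that Anke wins the statistics game. A statistic that is defined at `k`
certifies that there are `2 ^ k` times, any two of which enclose an even maximal priority
(`PriorityMap.IsWitness`, `PriorityMap.exists_times_of_last_mem`). If Boris had a positional
winning strategy in the parity game, then two of these times would have the same node and the same
player to move, as there are only `2 * card V` such positions, and Boris's strategy would admit
the infinite repetition of the loop between them, which Anke wins. Hence Boris has no positional
winning strategy.

It remains to see that Anke wins the parity game then (`borisWinsFrom_or_ankeWinsFrom`). This goes
by induction on the number of moves. If Boris has several moves at a position `v`, they are
divided into two nonempty sets, which gives two games with fewer moves. If Anke wins both of them,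
she combines her two strategies: whichever set Boris chooses from at `v`, she continues the
corresponding game from where it was left at its last visit to `v`. The resulting play is a
shuffle of plays of the two games, and the parity condition is stable under shuffles. To make this
convenient, a strategy is represented by a graph of memory states (`IsStrategyGraph`) instead of a
function of the history.
-/

open Filter

/-! ### Sequences with an even limit superior -/

/-- The values of the sequence `a` have an even limit superior that is attained infinitely often;
for a bounded sequence this says that the limit superior is even. -/
def EvenLimsup (a : ℕ → ℕ) : Prop :=
  ∃ c, Even c ∧ (∃ᶠ t in atTop, a t = c) ∧ ∀ᶠ t in atTop, a t ≤ c

/-- In a bounded sequence of natural numbers the limit superior occurs infinitely often. -/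
theorem frequently_eq_limsup {a : ℕ → ℕ} {m : ℕ} (ha : ∀ t, a t ≤ m) :
    (∃ᶠ t in atTop, a t = limsup a atTop) ∧ ∀ᶠ t in atTop, a t ≤ limsup a atTop := by
  have hb : IsBoundedUnder (· ≤ ·) atTop a := isBoundedUnder_of ⟨m, ha⟩
  have hle : ∀ᶠ t in atTop, a t ≤ limsup a atTop :=
    (eventually_lt_of_limsup_lt (Nat.lt_succ_self (limsup a atTop)) hb).mono
      fun t ht => Nat.lt_succ_iff.mp ht
  refine ⟨?_, hle⟩
  have hge : ∃ᶠ t in atTop, limsup a atTop ≤ a t := by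
    rcases Nat.eq_zero_or_pos (limsup a atTop) with h | h
    · rw [h]
      exact Frequently.of_forall fun t => Nat.zero_le _
    · exact (frequently_lt_of_lt_limsup
        (b := limsup a atTop - 1) (by isBoundedDefault) (Nat.sub_lt h one_pos)).mono
        fun t ht => by omega
  exact (hge.and_eventually hle).mono fun t ht => le_antisymm ht.2 ht.1

theorem evenLimsup_iff {a : ℕ → ℕ} {m : ℕ} (ha : ∀ t, a t ≤ m) :
    EvenLimsup a ↔ Even (limsup a atTop) := by
  obtain ⟨hf, hle⟩ := frequently_eq_limsup ha
  refine ⟨?_, fun h => ⟨_, h, hf, hle⟩⟩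
  rintro ⟨c, hc, hcf, hcle⟩
  obtain ⟨t, ht, ht'⟩ := (hcf.and_eventually hle).exists
  obtain ⟨u, hu, hu'⟩ := (hf.and_eventually hcle).exists
  have : limsup a atTop = c := by omega
  rwa [this]

/-- Even limits superior are stable under shuffling: it suffices that both subsequences have an
even limit superior, as far as they are infinite. -/
theorem evenLimsup_of_shuffle {a : ℕ → ℕ} {p : ℕ → Prop}
    (h1 : (∃ᶠ t in atTop, p t) →
      ∃ c, Even c ∧ (∃ᶠ t in atTop, p t ∧ a t = c) ∧ ∀ᶠ t in atTop, p t → a t ≤ c)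
    (h2 : (∃ᶠ t in atTop, ¬ p t) →
      ∃ c, Even c ∧ (∃ᶠ t in atTop, ¬ p t ∧ a t = c) ∧ ∀ᶠ t in atTop, ¬ p t → a t ≤ c) :
    EvenLimsup a := by
  by_cases hp : ∃ᶠ t in atTop, p t
  · obtain ⟨c, hc, hf, hle⟩ := h1 hp
    by_cases hq : ∃ᶠ t in atTop, ¬ p t
    · obtain ⟨d, hd, hf', hle'⟩ := h2 hq
      rcases le_total c d with hcd | hcd
      · refine ⟨d, hd, hf'.mono fun t ht => ht.2, ?_⟩
        filter_upwards [hle, hle'] with t h h'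
        by_cases hpt : p t
        · exact (h hpt).trans hcd
        · exact h' hpt
      · refine ⟨c, hc, hf.mono fun t ht => ht.2, ?_⟩
        filter_upwards [hle, hle'] with t h h'
        by_cases hpt : p t
        · exact h hpt
        · exact (h' hpt).trans hcd
    · refine ⟨c, hc, hf.mono fun t ht => ht.2, ?_⟩
      rw [not_frequently] at hq
      filter_upwards [hle, hq] with t h h'
      exact h (not_not.mp h')
  · rw [not_frequently] at hp
    obtain ⟨c, hc, hf, hle⟩ := h2 hp.frequently
    refine ⟨c, hc, hf.mono fun t ht => ht.2, ?_⟩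
    filter_upwards [hle, hp] with t h h'
    exact h h'

/-- Along a sequence that moves along `R` at the times in `p` and rests at all other times, the
states at the times in `p` form a path of `R`. -/
theorem rel_nth_of_rests {M : Type*} {R : M → M → Prop} {x : ℕ → M} {p : ℕ → Prop}
    (hp : (Set.ofPred p).Infinite) (hR : ∀ t, p t → R (x t) (x (t + 1)))
    (hrest : ∀ t, ¬ p t → x (t + 1) = x t) (n : ℕ) :
    R (x (Nat.nth p n)) (x (Nat.nth p (n + 1))) := by
  have hlt : Nat.nth p n < Nat.nth p (n + 1) := Nat.nth_strictMono hp (Nat.lt_succ_self n)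
  have hconst : ∀ u, Nat.nth p n + 1 ≤ u → u ≤ Nat.nth p (n + 1) →
      x u = x (Nat.nth p n + 1) := by
    intro u hu
    induction u, hu using Nat.le_induction with
    | base => exact fun _ => rfl
    | succ u hu ih =>
      intro hle
      rw [hrest u, ih (by omega)]
      intro hpu
      have := Nat.le_nth_of_lt_nth_succ (lt_of_lt_of_le (Nat.lt_succ_self u) hle) hpu
      omega
  rw [hconst _ hlt le_rfl]
  exact hR _ (Nat.nth_mem_of_infinite hp n)

/-- The even limit superior of a subsequence, expressed in terms of the whole sequence. -/
theorem EvenLimsup.of_nth {b : ℕ → ℕ} {p : ℕ → Prop} (hp : (Set.ofPred p).Infinite)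
    (h : EvenLimsup fun n => b (Nat.nth p n)) :
    ∃ c, Even c ∧ (∃ᶠ t in atTop, p t ∧ b t = c) ∧ ∀ᶠ t in atTop, p t → b t ≤ c := by
  classical
  obtain ⟨c, hc, hf, hle⟩ := h
  refine ⟨c, hc, ?_, ?_⟩
  · exact (Nat.nth_strictMono hp).tendsto_atTop.frequently
      (hf.mono fun n hn => ⟨Nat.nth_mem_of_infinite hp n, hn⟩)
  · obtain ⟨n, hn⟩ := eventually_atTop.mp hle
    refine eventually_atTop.mpr ⟨Nat.nth p n, fun t ht hpt => ?_⟩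
    have := hn (Nat.count p t) ?_
    · simpa only [Nat.nth_count hpt] using this
    · rwa [← Nat.nth_le_nth hp, Nat.nth_count hpt]

/-! ### Half-positional determinacy -/

/-- A strategy graph for Anke in the arena with successor sets `N`, where Boris moves at the
positions in `boris`. The states `m : M` stand for the memory of a strategy, `pos m` is the current
position, and `R` is the relation between consecutive states, which need not contain valid moves
only. The graph has a valid move wherever Anke is to move, it answers every move of Boris, and
*every* infinite path of `R`, from whatever state, has an even limit superior. -/
structure IsStrategyGraph {P M : Type*} (boris : Set P) (val : P → ℕ) (N : P → Finset P)
    (pos : M → P) (R : M → M → Prop) : Prop where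
  anke : ∀ m, pos m ∉ boris → ∃ m', R m m' ∧ pos m' ∈ N (pos m)
  boris : ∀ m, pos m ∈ boris → ∀ q ∈ N (pos m), ∃ m', R m m' ∧ pos m' = q
  wins : ∀ x : ℕ → M, (∀ t, R (x t) (x (t + 1))) → EvenLimsup fun t => val (pos (x t))

/-- Anke wins from `s`: some strategy graph has a state at `s`. -/
def AnkeWinsFrom {P : Type*} (boris : Set P) (val : P → ℕ) (N : P → Finset P) (s : P) : Prop :=
  ∃ (M : Type) (pos : M → P) (R : M → M → Prop),
    IsStrategyGraph boris val N pos R ∧ ∃ m, pos m = s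

/-- Boris wins from `s` with a positional strategy: he moves from `p` to `τ p`. -/
def BorisWinsFrom {P : Type*} (boris : Set P) (val : P → ℕ) (N : P → Finset P) (s : P) : Prop :=
  ∃ τ : P → P, (∀ p, τ p ∈ N p) ∧ ∀ x : ℕ → P, x 0 = s → (∀ t, x (t + 1) ∈ N (x t)) →
    (∀ t, x t ∈ boris → x (t + 1) = τ (x t)) → ¬ EvenLimsup fun t => val (x t)

section
variable {P : Type*} {boris : Set P} {val : P → ℕ} {N N₁ N₂ : P → Finset P}

/-- If Boris never has a choice, then either his only strategy wins, or Anke can follow a play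
that she wins. -/
theorem borisWinsFrom_or_ankeWinsFrom_of_card_le_one (hN : ∀ p, (N p).Nonempty)
    (h1 : ∀ p ∈ boris, (N p).card ≤ 1) (s : P) :
    BorisWinsFrom boris val N s ∨ AnkeWinsFrom boris val N s := by
  choose τ hτ using hN
  by_contra! hcon
  obtain ⟨hB, hA⟩ := hcon
  refine hB ⟨τ, hτ, fun x h0 hx _ hw => hA ⟨ℕ, x, fun m m' => m' = m + 1, ⟨?_, ?_, ?_⟩, 0, h0⟩⟩
  · exact fun m _ => ⟨m + 1, rfl, hx m⟩
  · exact fun m hm q hq => ⟨m + 1, rfl, Finset.card_le_one.mp (h1 _ hm) _ (hx m) _ hq⟩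
  · intro y hy
    have hy' : ∀ t, y t = t + y 0 := by
      intro t
      induction t with
      | zero => simp
      | succ t ih => rw [hy, ih]; omega
    obtain ⟨c, hc, hf, hle⟩ := hw
    rw [show (fun t => val (x (y t))) = fun t => val (x (t + y 0)) from
      funext fun t => by rw [hy' t]]
    refine ⟨c, hc, ?_, ?_⟩
    · rw [frequently_atTop] at hf ⊢
      intro n
      obtain ⟨b, hb, hbc⟩ := hf (n + y 0)
      exact ⟨b - y 0, by omega, by
        simpa only [Nat.sub_add_cancel (show y 0 ≤ b by omega)] using hbc⟩
    · exact (tendsto_add_atTop_nat (y 0)).eventually hle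

theorem BorisWinsFrom.mono {v s : P} (hv : v ∈ boris) (hsub : N₁ v ⊆ N v)
    (heq : ∀ p, p ≠ v → N₁ p = N p) (h : BorisWinsFrom boris val N₁ s) :
    BorisWinsFrom boris val N s := by
  obtain ⟨τ, hτ, h⟩ := h
  refine ⟨τ, fun p => ?_, fun x h0 hx hb => h x h0 (fun t => ?_) hb⟩
  · by_cases hp : p = v
    · subst hp; exact hsub (hτ p)
    · rw [← heq p hp]; exact hτ p
  · by_cases hp : x t = v
    · rw [hb t (hp ▸ hv)]; exact hτ _
    · rw [heq _ hp]; exact hx t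

/-- A strategy graph that avoids `v` does not depend on the moves at `v`. -/
theorem IsStrategyGraph.congr_of_avoids {M : Type} {pos : M → P} {R : M → M → Prop} {v : P}
    (h : IsStrategyGraph boris val N₁ pos R) (heq : ∀ p, p ≠ v → N₁ p = N p)
    (hv : ∀ m, pos m ≠ v) : IsStrategyGraph boris val N pos R where
  anke m hm := by rw [← heq _ (hv m)]; exact h.anke m hm
  boris m hm := by rw [← heq _ (hv m)]; exact h.boris m hm
  wins := h.wins

/-- The key step of determinacy. Suppose that the moves of Boris at `v` are covered by `N₁` and
`N₂`, and that Anke has strategy graphs for both that pass through `v`. In the combined graph both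
strategies are remembered, the inactive one rests at `v`, and the move of Boris at `v` decides which
one is continued. A path is a shuffle of a path of the first and a path of the second graph. -/
theorem IsStrategyGraph.ankeWinsFrom_of_shuffle {M₁ M₂ : Type} {pos₁ : M₁ → P} {pos₂ : M₂ → P}
    {R₁ : M₁ → M₁ → Prop} {R₂ : M₂ → M₂ → Prop} {v : P} (hv : v ∈ boris)
    (h₁ : IsStrategyGraph boris val N₁ pos₁ R₁) (h₂ : IsStrategyGraph boris val N₂ pos₂ R₂)
    (heq₁ : ∀ p, p ≠ v → N₁ p = N p) (heq₂ : ∀ p, p ≠ v → N₂ p = N p)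
    (hcov : ∀ q ∈ N v, q ∈ N₁ v ∨ q ∈ N₂ v) (m₁ : M₁) (m₂ : M₂) (hm₂ : pos₂ m₂ = v) :
    AnkeWinsFrom boris val N (pos₁ m₁) := by
  classical
  -- The Boolean is `true` if the first strategy is active; the other component then rests at `v`.
  let M := {x : M₁ × M₂ × Bool // if x.2.2 then pos₂ x.2.1 = v else pos₁ x.1 = v}
  let pos : M → P := fun x => if x.1.2.2 then pos₁ x.1.1 else pos₂ x.1.2.1
  let R : M → M → Prop := fun x y =>
    if y.1.2.2 then R₁ x.1.1 y.1.1 ∧ y.1.2.1 = x.1.2.1 else R₂ x.1.2.1 y.1.2.1 ∧ y.1.1 = x.1.1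
  refine ⟨M, pos, R, ⟨?_, ?_, ?_⟩, ⟨⟨(m₁, m₂, true), by simpa using hm₂⟩, by simp [pos]⟩⟩
  · rintro ⟨⟨a, b, i⟩, hi⟩ hm
    cases i with
    | true =>
      simp only [pos, if_true] at hi hm ⊢
      have hne : pos₁ a ≠ v := fun h => hm (h ▸ hv)
      obtain ⟨a', ha, ha'⟩ := h₁.anke a hm
      rw [heq₁ _ hne] at ha'
      exact ⟨⟨(a', b, true), by simpa using hi⟩, by simpa [R] using ha, by simpa using ha'⟩
    | false =>
      simp only [pos, if_false, Bool.false_eq_true] at hi hm ⊢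
      have hne : pos₂ b ≠ v := fun h => hm (h ▸ hv)
      obtain ⟨b', hb, hb'⟩ := h₂.anke b hm
      rw [heq₂ _ hne] at hb'
      exact ⟨⟨(a, b', false), by simpa using hi⟩, by simpa [R] using hb, by simpa using hb'⟩
  · rintro ⟨⟨a, b, i⟩, hi⟩ hm q hq
    by_cases hpv : pos ⟨⟨a, b, i⟩, hi⟩ = v
    · have hab : pos₁ a = v ∧ pos₂ b = v := by
        cases i with
        | true => exact ⟨by simpa [pos] using hpv, by simpa using hi⟩
        | false => exact ⟨by simpa using hi, by simpa [pos] using hpv⟩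
      obtain ⟨hav, hbv⟩ := hab
      rw [hpv] at hq
      rcases hcov q hq with h | h
      · obtain ⟨a', ha, ha'⟩ := h₁.boris a (hav ▸ hv) q (hav ▸ h)
        exact ⟨⟨(a', b, true), by simpa using hbv⟩, by simpa [R] using ha, by simpa [pos] using ha'⟩
      · obtain ⟨b', hb, hb'⟩ := h₂.boris b (hbv ▸ hv) q (hbv ▸ h)
        exact ⟨⟨(a, b', false), by simpa using hav⟩, by simpa [R] using hb,
          by simpa [pos] using hb'⟩
    · cases i with
      | true =>
        simp only [pos, if_true] at hi hm hq hpv ⊢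
        rw [← heq₁ _ hpv] at hq
        obtain ⟨a', ha, ha'⟩ := h₁.boris a hm q hq
        exact ⟨⟨(a', b, true), by simpa using hi⟩, by simpa [R] using ha, by simpa using ha'⟩
      | false =>
        simp only [pos, if_false, Bool.false_eq_true] at hi hm hq hpv ⊢
        rw [← heq₂ _ hpv] at hq
        obtain ⟨b', hb, hb'⟩ := h₂.boris b hm q hq
        exact ⟨⟨(a, b', false), by simpa using hi⟩, by simpa [R] using hb, by simpa using hb'⟩
  · intro x hx
    -- `p t` says that the move at time `t` is made by the first strategy.
    set p : ℕ → Prop := fun t => (x (t + 1)).1.2.2 = true with hp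
    have hR₁ : ∀ t, p t → R₁ (x t).1.1 (x (t + 1)).1.1 ∧ (x (t + 1)).1.2.1 = (x t).1.2.1 := by
      intro t ht
      simpa [R, show (x (t + 1)).1.2.2 = true from ht] using hx t
    have hR₂ : ∀ t, ¬ p t → R₂ (x t).1.2.1 (x (t + 1)).1.2.1 ∧ (x (t + 1)).1.1 = (x t).1.1 := by
      intro t ht
      simpa [R, show (x (t + 1)).1.2.2 = false by simpa [hp] using ht] using hx t
    have hpos₁ : ∀ t, p t → pos (x t) = pos₁ (x t).1.1 := by
      intro t ht
      have h := (x t).2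
      have h' := (x (t + 1)).2
      rw [show (x (t + 1)).1.2.2 = true from ht, (hR₁ t ht).2] at h'
      cases hi : (x t).1.2.2 <;> simp_all [pos]
    have hpos₂ : ∀ t, ¬ p t → pos (x t) = pos₂ (x t).1.2.1 := by
      intro t ht
      have h := (x t).2
      have h' := (x (t + 1)).2
      rw [show (x (t + 1)).1.2.2 = false by simpa [hp] using ht, (hR₂ t ht).2] at h'
      cases hi : (x t).1.2.2 <;> simp_all [pos]
    refine evenLimsup_of_shuffle (p := p) (fun hf => ?_) (fun hf => ?_)
    · have hinf : (Set.ofPred p).Infinite := Nat.frequently_atTop_iff_infinite.mp hf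
      obtain ⟨c, hc, hcf, hle⟩ := EvenLimsup.of_nth (b := fun t => val (pos₁ (x t).1.1)) hinf
        (h₁.wins _ (rel_nth_of_rests (x := fun t => (x t).1.1) hinf (fun t ht => (hR₁ t ht).1)
          fun t ht => (hR₂ t ht).2))
      exact ⟨c, hc, hcf.mono fun t ht => ⟨ht.1, by rw [hpos₁ t ht.1]; exact ht.2⟩,
        hle.mono fun t ht hpt => by rw [hpos₁ t hpt]; exact ht hpt⟩
    · have hinf : (Set.ofPred fun t => ¬ p t).Infinite := Nat.frequently_atTop_iff_infinite.mp hf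
      obtain ⟨c, hc, hcf, hle⟩ := EvenLimsup.of_nth (b := fun t => val (pos₂ (x t).1.2.1)) hinf
        (h₂.wins _ (rel_nth_of_rests (x := fun t => (x t).1.2.1) hinf (fun t ht => (hR₂ t ht).1)
          fun t ht => (hR₁ t (not_not.mp ht)).2))
      exact ⟨c, hc, hcf.mono fun t ht => ⟨ht.1, by rw [hpos₂ t ht.1]; exact ht.2⟩,
        hle.mono fun t ht hpt => by rw [hpos₂ t hpt]; exact ht hpt⟩

/-- Half-positional determinacy of finite parity games, by induction on the number of moves: if
Boris has several moves at `v`, they are split into two smaller games. -/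
theorem borisWinsFrom_or_ankeWinsFrom [Fintype P] (hN : ∀ p, (N p).Nonempty) (s : P) :
    BorisWinsFrom boris val N s ∨ AnkeWinsFrom boris val N s := by
  classical
  induction h : ∑ p, (N p).card using Nat.strong_induction_on generalizing N with
  | _ n ih =>
    by_cases h1 : ∀ p ∈ boris, (N p).card ≤ 1
    · exact borisWinsFrom_or_ankeWinsFrom_of_card_le_one hN h1 s
    push Not at h1
    obtain ⟨v, hv, hcard⟩ := h1
    obtain ⟨q, hq, q', hq', hne⟩ := Finset.one_lt_card.mp hcard
    have hsmaller : ∀ A : Finset P, A.Nonempty → A ⊂ N v →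
        BorisWinsFrom boris val (Function.update N v A) s ∨
          AnkeWinsFrom boris val (Function.update N v A) s := by
      intro A hA hAN
      refine ih _ ?_ (fun p => ?_) rfl
      · rw [← h]
        refine Finset.sum_lt_sum (fun p _ => ?_) ⟨v, Finset.mem_univ v, ?_⟩
        · by_cases hp : p = v
          · subst hp; simpa using Finset.card_le_card hAN.subset
          · simp [hp]
        · simpa using Finset.card_lt_card hAN
      · by_cases hp : p = v
        · subst hp; simpa using hA
        · simpa [hp] using hN p
    have heq : ∀ A : Finset P, ∀ p, p ≠ v → Function.update N v A p = N p :=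
      fun A p hp => by simp [hp]
    have hs₁ : {q} ⊂ N v :=
      Finset.ssubset_iff_subset_ne.mpr ⟨by simpa using hq, by rintro h; simp [← h] at hcard⟩
    have hs₂ : (N v).erase q ⊂ N v := Finset.erase_ssubset hq
    rcases hsmaller {q} (by simp) hs₁ with hB | ⟨M₁, pos₁, R₁, h₁, m₁, rfl⟩
    · exact Or.inl (hB.mono hv (by simpa using hq) (heq _))
    rcases hsmaller ((N v).erase q) ⟨q', by simp [hq', hne.symm]⟩ hs₂ with
      hB | ⟨M₂, pos₂, R₂, h₂, m₂, hm₂⟩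
    · exact Or.inl (hB.mono hv (by simpa using hs₂.subset) (heq _))
    refine Or.inr ?_
    by_cases hv₂ : ∀ m, pos₂ m ≠ v
    · exact ⟨M₂, pos₂, R₂, h₂.congr_of_avoids (heq _) hv₂, m₂, hm₂⟩
    push Not at hv₂
    obtain ⟨m, hm⟩ := hv₂
    refine h₁.ankeWinsFrom_of_shuffle hv h₂ (heq _) (heq _) (fun r hr => ?_) m₁ m hm
    by_cases hrq : r = q <;> simp [hrq, hr]

end

/-! ### The effect of an update -/

namespace PriorityMap

variable {k : ℕ} {f : PriorityMap k}

theorem insertAt_of_lt {l i : Fin (k + 1)} {c : ℕ} (h : l < i) : f.insertAt l c i = f i := by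
  simp [insertAt, h.not_gt, h.ne']

theorem insertAt_self {l : Fin (k + 1)} {c : ℕ} : f.insertAt l c l = some c := by
  simp [insertAt]

/-- What an update does: it either changes nothing, or is a single insertion. If both rules apply,
the insertion of the type I rule is erased again by the one of the type II rule. -/
theorem update_cases (f : PriorityMap k) (c : ℕ) :
    (¬ Even c ∧ (∀ i, ∀ b ∈ f i, c ≤ b) ∧ f.update c = f) ∨
    (∃ l, (∃ d ∈ f l, d < c) ∧ (∀ i, l < i → ∀ b ∈ f i, c ≤ b) ∧
      f.update c = f.insertAt l c) ∨
    ∃ j, Even c ∧ (∀ i < j, ∃ d ∈ f i, Even d) ∧ (j ≠ Fin.last k → ∀ d ∈ f j, ¬ Even d) ∧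
      (∀ i, j < i → ∀ b ∈ f i, c ≤ b) ∧ f.update c = f.insertAt j c := by
  have mem_below : ∀ (g : PriorityMap k) i, i ∈ g.below c ↔ ∃ d ∈ g i, d < c := by
    simp [below]
  have top : ∀ (g : PriorityMap k) (h : (g.below c).Nonempty), ∀ i,
      (g.below c).max' h < i → ∀ b ∈ g i, c ≤ b := by
    intro g h i hlt b hb
    by_contra! hcon
    exact absurd (Finset.le_max' _ _ ((mem_below g i).mpr ⟨b, hb, hcon⟩)) (not_le.mpr hlt)
  by_cases hc : Even c
  · have hj := Finset.max'_mem _ f.evenBelow_nonempty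
    have hj' : ∀ i ∈ f.evenBelow, i ≤ f.evenBelow.max' f.evenBelow_nonempty :=
      fun i hi => Finset.le_max' _ i hi
    have hI : f.ruleI c = f.insertAt (f.evenBelow.max' f.evenBelow_nonempty) c := by
      simp [ruleI, hc]
    unfold update
    rw [hI]
    generalize f.evenBelow.max' f.evenBelow_nonempty = j at hj hj'
    simp only [evenBelow, Finset.mem_filter, Finset.mem_univ, true_and] at hj hj'
    by_cases h : ((f.insertAt j c).below c).Nonempty
    · refine Or.inr (Or.inl ⟨((f.insertAt j c).below c).max' h, ?_⟩)
      have hl := (mem_below _ _).mp (Finset.max'_mem _ h)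
      have ht := top _ h
      rw [show (f.insertAt j c).ruleII c = _ from dif_pos h]
      generalize ((f.insertAt j c).below c).max' h = l at hl ht
      obtain ⟨d, hd, hdc⟩ := hl
      rcases insertAt_mem hd with ⟨-, rfl⟩ | ⟨hjl, hd⟩
      · exact absurd hdc (lt_irrefl _)
      refine ⟨⟨d, hd, hdc⟩, fun i hi b hb => ht i hi b ?_, ?_⟩
      · rwa [insertAt_of_lt (hjl.trans hi)]
      · funext i
        unfold insertAt
        split_ifs <;> first | rfl | omega
    · refine Or.inr (Or.inr ⟨j, hc, hj, fun hjk d hd hde => ?_, fun i hi b hb => ?_, ?_⟩)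
      · -- Otherwise `j + 1` would be an index of `f.evenBelow`.
        have hlt : j < Fin.last k := lt_of_le_of_ne (Fin.le_last j) hjk
        have hjk' : j.1 + 1 < k + 1 := by
          have := Fin.lt_def.mp hlt
          simp only [Fin.val_last] at this
          omega
        have := Fin.le_def.mp (hj' ⟨j.1 + 1, hjk'⟩ fun i hi => ?_)
        · simp at this
        · rcases lt_or_eq_of_le (show i ≤ j from Nat.lt_succ_iff.mp (Fin.lt_def.mp hi)) with h | rfl
          · exact hj i h
          · exact ⟨d, hd, hde⟩
      · by_contra! hcon
        exact h ⟨i, (mem_below _ _).mpr ⟨b, by rwa [insertAt_of_lt hi], hcon⟩⟩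
      · exact dif_neg h
  · have hI : f.ruleI c = f := by simp [ruleI, hc]
    unfold update
    rw [hI]
    by_cases h : (f.below c).Nonempty
    · exact Or.inr (Or.inl ⟨_, (mem_below _ _).mp (Finset.max'_mem _ h), top f h, dif_pos h⟩)
    · refine Or.inl ⟨hc, fun i b hb => ?_, dif_neg h⟩
      by_contra! hcon
      exact h ⟨i, (mem_below _ _).mpr ⟨b, hb, hcon⟩⟩

/-! ### Plays with an even limit superior reach the index `k` -/

/-- The digit of a statistic at the index `i`, with respect to the priority `C`. The digits
below the topmost value `< C` vanish. From this value on upwards, the digit is `1` at the value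
itself, `2` at even values `≥ C`, and `0` at odd values `≥ C` and undefined indices. -/
noncomputable def digit (C : ℕ) (f : PriorityMap k) (i : Fin (k + 1)) : Fin 3 :=
  open Classical in
  if ∃ j, i < j ∧ ∃ d ∈ f j, d < C then 0
  else if ∃ d ∈ f i, d < C then 1
  else if ∃ d ∈ f i, Even d then 2
  else 0

theorem digit_congr {C : ℕ} {f g : PriorityMap k} {i : Fin (k + 1)} (h : ∀ j, i ≤ j → f j = g j) :
    digit C f i = digit C g i := by
  have h1 : (∃ j, i < j ∧ ∃ d ∈ f j, d < C) ↔ ∃ j, i < j ∧ ∃ d ∈ g j, d < C :=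
    exists_congr fun j => and_congr_right fun hij => by rw [h j hij.le]
  simp only [digit, h1, h i le_rfl]

theorem digit_eq_zero {C : ℕ} {f : PriorityMap k} {i j : Fin (k + 1)} (hij : i < j)
    (h : ∃ d ∈ f j, d < C) : digit C f i = 0 :=
  if_pos ⟨j, hij, h⟩

theorem digit_eq_one {C : ℕ} {f : PriorityMap k} {i : Fin (k + 1)}
    (h : ∀ j, i < j → ∀ b ∈ f j, C ≤ b) (hi : ∃ d ∈ f i, d < C) : digit C f i = 1 := by
  have h' : ¬ ∃ j, i < j ∧ ∃ d ∈ f j, d < C := by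
    rintro ⟨j, hij, d, hd, hdC⟩
    exact absurd (h j hij d hd) (not_le.mpr hdC)
  rw [digit, if_neg h', if_pos hi]

/-- Insertion of `C` itself at an index above which all values are `≥ C`. -/
theorem digit_insertAt_self {C : ℕ} {l : Fin (k + 1)} (hC : Even C)
    (h : ∀ j, l < j → ∀ b ∈ f j, C ≤ b) : digit C (f.insertAt l C) l = 2 := by
  have h' : ¬ ∃ j, l < j ∧ ∃ d ∈ f.insertAt l C j, d < C := by
    rintro ⟨j, hij, d, hd, hdC⟩
    rw [insertAt_of_lt hij] at hd
    exact absurd (h j hij d hd) (not_le.mpr hdC)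
  rw [digit, if_neg h', if_neg (by simp [insertAt_self]), if_pos (by simpa [insertAt_self])]

theorem digit_le_one {C : ℕ} {l : Fin (k + 1)} (h : ∀ d ∈ f l, ¬ (C ≤ d ∧ Even d)) :
    digit C f l ≤ 1 := by
  have h' : (∃ d ∈ f l, Even d) → ∃ d ∈ f l, d < C := by
    rintro ⟨d, hd, hde⟩
    exact ⟨d, hd, by by_contra! hcon; exact h d hd ⟨hcon, hde⟩⟩
  unfold digit
  split_ifs with h1 h2 h3
  · decide
  · decide
  · exact absurd (h' h3) h2
  · decide

/-- The digits of a statistic, the digit at the highest index being the most significant one. -/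
noncomputable def digits (C : ℕ) (f : PriorityMap k) : Colex (Fin (k + 1) → Fin 3) :=
  toColex (digit C f)

theorem digits_lt_insertAt {C d : ℕ} {l : Fin (k + 1)}
    (h : digit C f l < digit C (f.insertAt l d) l) : digits C f < digits C (f.insertAt l d) :=
  ⟨l, fun _ hj => digit_congr fun _ hi => (insertAt_of_lt (lt_of_lt_of_le hj hi)).symm, h⟩

/-- As long as the index `k` is not reached, an update by an even `C` increments the digits. -/
theorem digits_lt_update_self {C : ℕ} (hC : Even C) (hk : f (Fin.last k) = none) :
    digits C f < digits C (f.update C) := by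
  rcases f.update_cases C with ⟨h, -⟩ | ⟨l, ⟨d, hd, hdC⟩, hl, h⟩ | ⟨j, -, -, hj, hl, h⟩
  · exact absurd hC h
  · rw [h]
    refine digits_lt_insertAt ?_
    rw [digit_insertAt_self hC hl, digit_eq_one hl ⟨d, hd, hdC⟩]
    decide
  · rw [h]
    refine digits_lt_insertAt ?_
    rw [digit_insertAt_self hC hl]
    refine lt_of_le_of_lt (digit_le_one fun d hd hde => ?_) (show (1 : Fin 3) < 2 by decide)
    by_cases hjk : j = Fin.last k
    · rw [hjk, hk] at hd
      simp at hd
    · exact hj hjk d hd hde.2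

/-- An insertion of `d < C` at an index without an even value `≥ C` does not decrease the
digits. -/
theorem digits_le_insertAt {C d : ℕ} {l : Fin (k + 1)} (hdC : d < C)
    (hl : ∀ b ∈ f l, ¬ (C ≤ b ∧ Even b)) : digits C f ≤ digits C (f.insertAt l d) := by
  have hsame : ∀ i, l < i → digit C f i = digit C (f.insertAt l d) i := fun i hi =>
    digit_congr fun j hj => (insertAt_of_lt (lt_of_lt_of_le hi hj)).symm
  by_cases htop : ∃ j, l < j ∧ ∃ b ∈ f j, b < C
  · -- Below the topmost value `< C` all digits vanish before and after the insertion.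
    obtain ⟨j, hlj, hj⟩ := htop
    have hj' : ∃ b ∈ f.insertAt l d j, b < C := by rwa [insertAt_of_lt hlj]
    refine le_of_eq (congrArg toColex (funext fun i => ?_))
    rcases lt_or_ge l i with h | h
    · exact hsame i h
    · rw [digit_eq_zero (lt_of_le_of_lt h hlj) hj, digit_eq_zero (lt_of_le_of_lt h hlj) hj']
  · push Not at htop
    have hl' : ∃ b ∈ f.insertAt l d l, b < C := ⟨d, by simp [insertAt_self], hdC⟩
    have h1 : digit C (f.insertAt l d) l = 1 :=
      digit_eq_one (fun j hj b hb => htop j hj b (by rwa [insertAt_of_lt hj] at hb)) hl'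
    rcases lt_or_eq_of_le (digit_le_one hl) with h | h
    · exact (digits_lt_insertAt (by rwa [h1])).le
    · have hlt : ∃ b ∈ f l, b < C := by
        by_contra hcon
        have h0 : ¬ ∃ b ∈ f l, Even b := by
          rintro ⟨b, hb, hbe⟩
          exact hcon ⟨b, hb, by by_contra! hcon'; exact hl b hb ⟨hcon', hbe⟩⟩
        rw [digit, if_neg hcon, if_neg h0, ite_self] at h
        exact absurd h (by decide)
      refine le_of_eq (congrArg toColex (funext fun i => ?_))
      rcases lt_trichotomy l i with hi | rfl | hi
      · exact hsame i hi
      · rw [h, h1]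
      · rw [digit_eq_zero hi hlt, digit_eq_zero hi hl']

/-- As long as the index `k` is not reached, an update by a priority `≤ C` does not decrease the
digits. -/
theorem digits_le_update {C d : ℕ} (hC : Even C) (hd : d ≤ C) (hk : f (Fin.last k) = none) :
    digits C f ≤ digits C (f.update d) := by
  rcases hd.eq_or_lt with rfl | hdC
  · exact (digits_lt_update_self hC hk).le
  rcases f.update_cases d with ⟨-, -, h⟩ | ⟨l, ⟨b, hb, hbd⟩, hl, h⟩ | ⟨j, -, -, hj, hl, h⟩
  · rw [h]
  · rw [h]
    refine digits_le_insertAt hdC fun b' hb' hcon => ?_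
    rw [Option.mem_unique hb hb'] at hbd
    omega
  · rw [h]
    refine digits_le_insertAt hdC fun b hb hbe => ?_
    by_cases hjk : j = Fin.last k
    · rw [hjk, hk] at hb
      simp at hb
    · exact hj hjk b hb hbe.2

/-- The statistics along a sequence of priorities with an even limit superior eventually reach the
index `k`: otherwise the digits would increase infinitely often. -/
theorem exists_last_mem_of_evenLimsup {a : ℕ → ℕ} (ha : EvenLimsup a) {f : ℕ → PriorityMap k}
    (hf : ∀ t, f (t + 1) = (f t).update (a t)) : ∃ t, (f t (Fin.last k)).isSome := by
  by_contra! hcon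
  have hk : ∀ t, f t (Fin.last k) = none := fun t => by simpa using hcon t
  obtain ⟨C, hC, hfreq, hle⟩ := ha
  obtain ⟨T, hT⟩ := eventually_atTop.mp hle
  have hmono : Monotone fun n => digits C (f (T + n)) := by
    refine monotone_nat_of_le_succ fun n => ?_
    rw [← add_assoc, hf]
    exact digits_le_update hC (hT _ (by omega)) (hk _)
  have : Finite (Colex (Fin (k + 1) → Fin 3)) :=
    inferInstanceAs (Finite (Fin (k + 1) → Fin 3))
  obtain ⟨n, hn⟩ := WellFoundedGT.monotone_chain_condition
    (⟨fun n => digits C (f (T + n)), hmono⟩ : ℕ →o Colex (Fin (k + 1) → Fin 3))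
  obtain ⟨t, ht, htC⟩ := frequently_atTop.mp hfreq (T + n)
  have hlt := digits_lt_update_self (f := f t) hC (hk t)
  have h1 := hn (t - T) (by omega)
  have h2 := hn (t + 1 - T) (by omega)
  simp only [OrderHom.coe_mk, show T + (t - T) = t by omega,
    show T + (t + 1 - T) = t + 1 by omega] at h1 h2
  rw [← htC, ← hf, htC, ← h1, ← h2] at hlt
  exact lt_irrefl _ hlt

end PriorityMap

/-! ### Statistics as certificates for loops -/

/-- The maximum of the values `a x, …, a (y - 1)`. -/
def maxIco (a : ℕ → ℕ) (x y : ℕ) : ℕ := (Finset.Ico x y).sup a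

theorem maxIco_succ (a : ℕ → ℕ) {x y : ℕ} (h : x ≤ y) :
    maxIco a x (y + 1) = max (maxIco a x y) (a y) := by
  rw [maxIco, maxIco, ← Finset.insert_Ico_right_eq_Ico_add_one h, Finset.sup_insert, max_comm]

theorem maxIco_self_succ (a : ℕ → ℕ) (x : ℕ) : maxIco a x (x + 1) = a x := by
  simp [maxIco]

theorem even_max {m n : ℕ} (hm : Even m) (hn : Even n) : Even (max m n) := by
  rcases max_choice m n with h | h <;> rwa [h]

namespace PriorityMap

variable {k : ℕ} {f : PriorityMap k}

/-- The times in `S i` witness that the statistic `f` can arise at time `t` from the priorities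
`a 0, …, a (t - 1)`. If `f i` is defined, then `S i` consists of `2 ^ i` times, any two of which
enclose an even maximal priority, and `f i` is the maximal priority since each of these times,
unless that maximum is even and larger. Higher indices have earlier times, and the
times at a higher index with an even value can be joined to those at a lower one. -/
structure IsWitness (a : ℕ → ℕ) (t : ℕ) (f : PriorityMap k) (S : Fin (k + 1) → Finset ℕ) :
    Prop where
  card : ∀ i, ∀ d ∈ f i, (S i).card = 2 ^ (i : ℕ)
  lt : ∀ i, ∀ d ∈ f i, ∀ x ∈ S i, x < t
  even : ∀ i, ∀ d ∈ f i, ∀ x ∈ S i, ∀ y ∈ S i, x < y → Even (maxIco a x (y + 1))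
  value : ∀ i, ∀ d ∈ f i, ∀ x ∈ S i, d ≤ maxIco a x t ∧ (Even (maxIco a x t) ∨ maxIco a x t = d)
  cross_lt : ∀ i j, i < j → ∀ d ∈ f i, ∀ e ∈ f j, ∀ x ∈ S j, ∀ y ∈ S i, x < y
  cross_even : ∀ i j, i < j → ∀ d ∈ f i, ∀ e ∈ f j, Even e → ∀ x ∈ S j, ∀ y ∈ S i,
    Even (maxIco a x (y + 1))

variable {a : ℕ → ℕ} {t : ℕ} {S : Fin (k + 1) → Finset ℕ}

theorem IsWitness.even_maxIco (h : IsWitness a t f S) {i : Fin (k + 1)} {d x : ℕ} (hd : d ∈ f i)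
    (hde : Even d) (hx : x ∈ S i) : Even (maxIco a x t) := by
  rcases (h.value i d hd x hx).2 with h | h
  · exact h
  · rwa [h]

/-- A priority not above the value of an index does not change the maxima for this index. -/
theorem IsWitness.maxIco_succ_eq (h : IsWitness a t f S) {i : Fin (k + 1)} {d x : ℕ} (hd : d ∈ f i)
    (hle : a t ≤ d) (hx : x ∈ S i) : maxIco a x (t + 1) = maxIco a x t := by
  rw [maxIco_succ a (h.lt i d hd x hx).le, max_eq_left (hle.trans (h.value i d hd x hx).1)]

theorem IsWitness.value_succ (h : IsWitness a t f S) {i : Fin (k + 1)} {d x : ℕ} (hd : d ∈ f i)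
    (hle : a t ≤ d) (hx : x ∈ S i) :
    d ≤ maxIco a x (t + 1) ∧ (Even (maxIco a x (t + 1)) ∨ maxIco a x (t + 1) = d) := by
  rw [h.maxIco_succ_eq hd hle hx]
  exact h.value i d hd x hx

/-- If nothing is below `a t`, then `f` and its witness remain valid. -/
theorem IsWitness.succ (h : IsWitness a t f S) (hle : ∀ i, ∀ d ∈ f i, a t ≤ d) :
    IsWitness a (t + 1) f S where
  card := h.card
  lt i d hd x hx := (h.lt i d hd x hx).trans (Nat.lt_succ_self t)
  even := h.even
  value i d hd _ hx := h.value_succ hd (hle i d hd) hx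
  cross_lt := h.cross_lt
  cross_even := h.cross_even

/-- The type II rule replaces a value by a larger one and keeps the times of that index. -/
theorem IsWitness.succ_replace (h : IsWitness a t f S) {l : Fin (k + 1)} {e : ℕ} (he : e ∈ f l)
    (hlt : e < a t) (hle : ∀ i, l < i → ∀ d ∈ f i, a t ≤ d) :
    IsWitness a (t + 1) (f.insertAt l (a t)) S where
  card i d hd := by
    rcases insertAt_mem hd with ⟨rfl, rfl⟩ | ⟨hi, hd⟩
    · exact h.card i e he
    · exact h.card i d hd
  lt i d hd x hx := by
    rcases insertAt_mem hd with ⟨rfl, rfl⟩ | ⟨hi, hd⟩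
    · exact (h.lt i e he x hx).trans (Nat.lt_succ_self t)
    · exact (h.lt i d hd x hx).trans (Nat.lt_succ_self t)
  even i d hd := by
    rcases insertAt_mem hd with ⟨rfl, rfl⟩ | ⟨hi, hd⟩
    · exact h.even i e he
    · exact h.even i d hd
  value i d hd x hx := by
    rcases insertAt_mem hd with ⟨rfl, rfl⟩ | ⟨hi, hd⟩
    · rw [maxIco_succ a (h.lt i e he x hx).le]
      refine ⟨le_max_right _ _, ?_⟩
      rcases le_total (maxIco a x t) (a t) with hm | hm
      · exact Or.inr (max_eq_right hm)
      · -- The maximum is above the old value, so it is even.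
        rw [max_eq_left hm]
        exact Or.inl ((h.value i e he x hx).2.resolve_right (by omega))
    · exact h.value_succ hd (hle i hi d hd) hx
  cross_lt i j hij d hd b hb := by
    rcases insertAt_mem hb with ⟨rfl, rfl⟩ | ⟨hj, hb'⟩
    · rcases insertAt_mem hd with ⟨rfl, rfl⟩ | ⟨hi, hd⟩
      · exact absurd hij (lt_irrefl _)
      · exact absurd (hij.trans hi) (lt_irrefl _)
    · rcases insertAt_mem hd with ⟨rfl, rfl⟩ | ⟨hi, hd⟩
      · exact h.cross_lt i j hij e he b hb'
      · exact h.cross_lt i j hij d hd b hb'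
  cross_even i j hij d hd b hb := by
    rcases insertAt_mem hb with ⟨rfl, rfl⟩ | ⟨hj, hb'⟩
    · rcases insertAt_mem hd with ⟨rfl, rfl⟩ | ⟨hi, hd⟩
      · exact absurd hij (lt_irrefl _)
      · exact absurd (hij.trans hi) (lt_irrefl _)
    · rcases insertAt_mem hd with ⟨rfl, rfl⟩ | ⟨hi, hd⟩
      · exact h.cross_even i j hij e he b hb'
      · exact h.cross_even i j hij d hd b hb'

/-- The type I rule joins the times of the indices below `j` and the current time; there are
`(1 + 2 + ⋯ + 2 ^ (j - 1)) + 1 = 2 ^ j` of them. -/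
theorem IsWitness.succ_join (h : IsWitness a t f S) {j : Fin (k + 1)} (hc : Even (a t))
    (hj : ∀ i < j, ∃ d ∈ f i, Even d) (hle : ∀ i, j < i → ∀ d ∈ f i, a t ≤ d) :
    IsWitness a (t + 1) (f.insertAt j (a t))
      (Function.update S j (insert t ((Finset.Iio j).biUnion S))) := by
  have hSj : Function.update S j (insert t ((Finset.Iio j).biUnion S)) j =
      insert t ((Finset.Iio j).biUnion S) := by simp
  have hSi : ∀ i, j < i →
      Function.update S j (insert t ((Finset.Iio j).biUnion S)) i = S i :=
    fun i hi => by simp [hi.ne']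
  generalize Function.update S j (insert t ((Finset.Iio j).biUnion S)) = S' at hSj hSi ⊢
  have hmem : ∀ x ∈ S' j, x = t ∨ ∃ i < j, x ∈ S i := by
    intro x hx
    simpa [hSj] using hx
  have hlt : ∀ i < j, ∀ x ∈ S i, x < t := by
    intro i hi x hx
    obtain ⟨d, hd, -⟩ := hj i hi
    exact h.lt i d hd x hx
  have heven : ∀ i < j, ∀ x ∈ S i, Even (maxIco a x t) := by
    intro i hi x hx
    obtain ⟨d, hd, hde⟩ := hj i hi
    exact h.even_maxIco hd hde hx
  have heven' : ∀ i < j, ∀ x ∈ S i, Even (maxIco a x (t + 1)) := by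
    intro i hi x hx
    rw [maxIco_succ a (hlt i hi x hx).le]
    exact even_max (heven i hi x hx) hc
  refine ⟨fun i d hd => ?_, fun i d hd x hx => ?_, fun i d hd x hx y hy hxy => ?_,
    fun i d hd x hx => ?_, fun i i' hii d hd e he x hx y hy => ?_,
    fun i i' hii d hd e he hee x hx y hy => ?_⟩
  · rcases insertAt_mem hd with ⟨rfl, rfl⟩ | ⟨hi, hd⟩
    · have hdisj : ((Finset.Iio i : Finset (Fin (k + 1))) : Set (Fin (k + 1))).PairwiseDisjoint
          S := by
        intro p hp q hq hpq
        simp only [Finset.coe_Iio, Set.mem_Iio] at hp hq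
        obtain ⟨d, hd, -⟩ := hj p hp
        obtain ⟨e, he, -⟩ := hj q hq
        refine Finset.disjoint_left.mpr fun x hxp hxq => ?_
        rcases lt_or_gt_of_ne hpq with hlt' | hlt'
        · exact lt_irrefl _ (h.cross_lt p q hlt' d hd e he x hxq x hxp)
        · exact lt_irrefl _ (h.cross_lt q p hlt' e he d hd x hxp x hxq)
      have hnot : t ∉ (Finset.Iio i).biUnion S := by
        intro hmem
        obtain ⟨p, hp, ht⟩ := Finset.mem_biUnion.mp hmem
        exact lt_irrefl _ (hlt p (Finset.mem_Iio.mp hp) t ht)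
      rw [hSj, Finset.card_insert_of_notMem hnot, Finset.card_biUnion hdisj,
        Finset.sum_congr rfl (g := fun p : Fin (k + 1) => 2 ^ (p : ℕ)) fun p hp => by
          obtain ⟨d, hd, -⟩ := hj p (Finset.mem_Iio.mp hp)
          exact h.card p d hd]
      have hsum : ∑ p ∈ Finset.Iio i, 2 ^ (p : ℕ) = ∑ p ∈ Finset.range (i : ℕ), 2 ^ p := by
        rw [← Nat.Iio_eq_range, ← Fin.map_valEmbedding_Iio, Finset.sum_map]
        rfl
      rw [hsum, Nat.geomSum_eq le_rfl]
      have := Nat.one_le_two_pow (n := (i : ℕ))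
      omega
    · rw [hSi i hi]
      exact h.card i d hd
  · rcases insertAt_mem hd with ⟨rfl, rfl⟩ | ⟨hi, hd⟩
    · rcases hmem x hx with rfl | ⟨p, hp, hxp⟩
      · exact Nat.lt_succ_self x
      · exact (hlt p hp x hxp).trans (Nat.lt_succ_self t)
    · rw [hSi i hi] at hx
      exact (h.lt i d hd x hx).trans (Nat.lt_succ_self t)
  · rcases insertAt_mem hd with ⟨rfl, rfl⟩ | ⟨hi, hd⟩
    · rcases hmem y hy with rfl | ⟨q, hq, hyq⟩
      · rcases hmem x hx with rfl | ⟨p, hp, hxp⟩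
        · exact absurd hxy (lt_irrefl _)
        · exact heven' p hp x hxp
      · rcases hmem x hx with rfl | ⟨p, hp, hxp⟩
        · exact absurd (hxy.trans (hlt q hq y hyq)) (lt_irrefl _)
        · obtain ⟨d, hd, hde⟩ := hj p hp
          obtain ⟨e, he, -⟩ := hj q hq
          rcases lt_trichotomy p q with hpq | rfl | hpq
          · exact absurd hxy (h.cross_lt p q hpq d hd e he y hyq x hxp).not_gt
          · exact h.even p d hd x hxp y hyq hxy
          · exact h.cross_even q p hpq e he d hd hde x hxp y hyq
    · rw [hSi i hi] at hx hy
      exact h.even i d hd x hx y hy hxy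
  · rcases insertAt_mem hd with ⟨rfl, rfl⟩ | ⟨hi, hd⟩
    · rcases hmem x hx with rfl | ⟨p, hp, hxp⟩
      · rw [maxIco_self_succ]
        exact ⟨le_rfl, Or.inr rfl⟩
      · refine ⟨?_, Or.inl (heven' p hp x hxp)⟩
        rw [maxIco_succ a (hlt p hp x hxp).le]
        exact le_max_right _ _
    · rw [hSi i hi] at hx
      exact h.value_succ hd (hle i hi d hd) hx
  · rcases insertAt_mem he with ⟨rfl, rfl⟩ | ⟨hi', he'⟩
    · rcases insertAt_mem hd with ⟨rfl, rfl⟩ | ⟨hi, hd⟩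
      · exact absurd hii (lt_irrefl _)
      · exact absurd (hii.trans hi) (lt_irrefl _)
    · rw [hSi i' hi'] at hx
      rcases insertAt_mem hd with ⟨rfl, rfl⟩ | ⟨hi, hd⟩
      · rcases hmem y hy with rfl | ⟨q, hq, hyq⟩
        · exact h.lt i' e he' x hx
        · obtain ⟨b, hb, -⟩ := hj q hq
          exact h.cross_lt q i' (hq.trans hi') b hb e he' x hx y hyq
      · rw [hSi i hi] at hy
        exact h.cross_lt i i' hii d hd e he' x hx y hy
  · rcases insertAt_mem he with ⟨rfl, rfl⟩ | ⟨hi', he'⟩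
    · rcases insertAt_mem hd with ⟨rfl, rfl⟩ | ⟨hi, hd⟩
      · exact absurd hii (lt_irrefl _)
      · exact absurd (hii.trans hi) (lt_irrefl _)
    · rw [hSi i' hi'] at hx
      rcases insertAt_mem hd with ⟨rfl, rfl⟩ | ⟨hi, hd⟩
      · rcases hmem y hy with rfl | ⟨q, hq, hyq⟩
        · rw [h.maxIco_succ_eq he' (hle i' hi' e he') hx]
          exact h.even_maxIco he' hee hx
        · obtain ⟨b, hb, -⟩ := hj q hq
          exact h.cross_even q i' (hq.trans hi') b hb e he' hee x hx y hyq
      · rw [hSi i hi] at hy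
        exact h.cross_even i i' hii d hd e he' hee x hx y hy

theorem IsWitness.update (h : IsWitness a t f S) :
    ∃ S', IsWitness a (t + 1) (f.update (a t)) S' := by
  rcases f.update_cases (a t) with ⟨-, hle, h'⟩ | ⟨l, ⟨e, he, hlt⟩, hle, h'⟩ |
    ⟨j, hc, hj, -, hle, h'⟩ <;> rw [h']
  · exact ⟨S, h.succ hle⟩
  · exact ⟨S, h.succ_replace he hlt hle⟩
  · exact ⟨_, h.succ_join hc hj hle⟩

theorem exists_isWitness {f : ℕ → PriorityMap k} (h0 : f 0 = fun _ => none)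
    (hf : ∀ t, f (t + 1) = (f t).update (a t)) (t : ℕ) : ∃ S, IsWitness a t (f t) S := by
  induction t with
  | zero => exact ⟨fun _ => ∅, by rw [h0]; constructor <;> simp⟩
  | succ t ih =>
    obtain ⟨S, hS⟩ := ih
    rw [hf]
    exact hS.update

/-- If the statistics along `a` reach the index `k`, then there are `2 ^ k` times, any two of which
enclose an even maximal priority. -/
theorem exists_times_of_last_mem {f : ℕ → PriorityMap k} (h0 : f 0 = fun _ => none)
    (hf : ∀ t, f (t + 1) = (f t).update (a t)) {t : ℕ} (ht : (f t (Fin.last k)).isSome) :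
    ∃ S : Finset ℕ, S.card = 2 ^ k ∧
      ∀ x ∈ S, ∀ y ∈ S, x < y → Even (maxIco a x (y + 1)) := by
  obtain ⟨S, hS⟩ := exists_isWitness h0 hf t
  obtain ⟨d, hd⟩ := Option.isSome_iff_exists.mp ht
  exact ⟨S (Fin.last k), hS.card _ d hd, hS.even _ d hd⟩

end PriorityMap

/-! ### Parity games as arenas with two players -/

namespace ParityGame

variable {V : Type*} (G : ParityGame V)

/-- In the arena on `V × Bool` the second component is `true` if Boris is to move. -/
def borisPositions (V : Type*) : Set (V × Bool) := {p | p.2 = true}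

/-- The successors of a position: the node moves along an edge and the turn changes. -/
noncomputable def successors [Fintype V] (p : V × Bool) : Finset (V × Bool) :=
  open Classical in Finset.univ.filter fun q => G.Edge p.1 q.1 ∧ q.2 = !p.2

theorem mem_successors [Fintype V] {p q : V × Bool} :
    q ∈ G.successors p ↔ G.Edge p.1 q.1 ∧ q.2 = !p.2 := by
  simp [successors]

theorem successors_nonempty [Fintype V] (p : V × Bool) : (G.successors p).Nonempty := by
  obtain ⟨w, hw⟩ := G.exists_edge p.1
  exact ⟨(w, !p.2), G.mem_successors.mpr ⟨hw, rfl⟩⟩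

theorem decide_odd_succ (t : ℕ) : decide (Odd (t + 1)) = !decide (Odd t) := by
  by_cases h : Odd t <;> simp [Nat.odd_add_one, h]

/-- A rule that depends on the history determines a sequence. -/
theorem exists_seq_of_rule (F : List V → V → V) (s : V) :
    ∃ v : ℕ → V, v 0 = s ∧ ∀ t, v (t + 1) = F ((List.range t).map v) (v t) := by
  let hist : ℕ → List V × V := fun t => t.rec ([], s) fun _ p => (p.1 ++ [p.2], F p.1 p.2)
  have hhist : ∀ t, (hist t).1 = (List.range t).map fun u => (hist u).2 := by
    intro t
    induction t with
    | zero => rfl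
    | succ t ih =>
      rw [List.range_succ, List.map_append, ← ih]
      rfl
  refine ⟨fun t => (hist t).2, rfl, fun t => ?_⟩
  rw [← hhist t]

theorem ankeWinsPlay_iff (v : ℕ → V) :
    G.AnkeWinsPlay v ↔ EvenLimsup fun t => G.val (v t) :=
  (evenLimsup_iff fun t => (G.val_mem (v t)).2).symm

theorem statistic_zero (k : ℕ) (v : ℕ → V) : (G.statistic k v 0).1 = fun _ => none := rfl

theorem statistic_succ (k : ℕ) (v : ℕ → V) (t : ℕ) :
    (G.statistic k v (t + 1)).1 = (G.statistic k v t).1.update (G.val (v t)) := rfl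

/-- A strategy graph yields a strategy: Anke tracks the state of the graph along the history. -/
theorem ankeWinsParityGame_of_ankeWinsFrom [Fintype V]
    (h : AnkeWinsFrom (borisPositions V) (fun p => G.val p.1) G.successors (G.start, false)) :
    G.AnkeWinsParityGame := by
  classical
  obtain ⟨M, pos, R, hG, m₀, hm₀⟩ := h
  -- `step m w` is the state that follows `m` when the play moves to `w`.
  let step : M → V → M := fun m w =>
    if h : ∃ m', R m m' ∧ pos m' = (w, !(pos m).2) then h.choose else m
  have hstep : ∀ m w, (∃ m', R m m' ∧ pos m' = (w, !(pos m).2)) →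
      R m (step m w) ∧ pos (step m w) = (w, !(pos m).2) := by
    intro m w h
    simp only [step, dif_pos h]
    exact h.choose_spec
  let good : List V → V → V → Prop := fun h v w =>
    G.Edge v w ∧ ∃ m', R ((h ++ [v]).tail.foldl step m₀) m' ∧ pos m' = (w, true)
  let σ : G.Strategy :=
    { next := fun h v => if hw : ∃ w, good h v w then hw.choose else (G.exists_edge v).choose
      valid := by
        intro h v
        split_ifs with hw
        · exact hw.choose_spec.1
        · exact (G.exists_edge v).choose_spec }
  have hσ : ∀ h v, (∃ w, good h v w) → good h v (σ.next h v) := by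
    intro h v hw
    simp only [σ, dif_pos hw]
    exact hw.choose_spec
  refine ⟨σ, fun v hv hfol => (G.ankeWinsPlay_iff v).mpr ?_⟩
  let x : ℕ → M := fun t => ((List.range t).map fun u => v (u + 1)).foldl step m₀
  have hx : ∀ t, x (t + 1) = step (x t) (v (t + 1)) := by
    intro t
    simp [x, List.range_succ]
  have hhist : ∀ t, ((List.range t).map v ++ [v t]).tail =
      (List.range t).map fun u => v (u + 1) := by
    intro t
    rw [← List.map_singleton, ← List.map_append, ← List.range_succ, List.range_succ_eq_map]
    simp [Function.comp_def]
  have hmove : ∀ t, pos (x t) = (v t, decide (Odd t)) →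
      R (x t) (x (t + 1)) ∧ pos (x (t + 1)) = (v (t + 1), decide (Odd (t + 1))) := by
    intro t ht
    rw [hx, decide_odd_succ, show decide (Odd t) = (pos (x t)).2 by rw [ht]]
    refine hstep _ _ ?_
    by_cases hodd : Odd t
    · refine hG.boris (x t) (by simp [borisPositions, ht, hodd]) _ ?_
      rw [G.mem_successors, ht]
      exact ⟨hv.2 t, rfl⟩
    · obtain ⟨m', hm', hpos⟩ := hG.anke (x t) (by simp [borisPositions, ht, hodd])
      rw [G.mem_successors, ht] at hpos
      have hg : ∃ w, good ((List.range t).map v) (v t) w := by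
        refine ⟨(pos m').1, hpos.1, m', ?_, Prod.ext rfl (by simpa [hodd] using hpos.2)⟩
        rwa [hhist]
      have := (hσ _ _ hg).2
      rw [hhist, ← hfol t (Nat.not_odd_iff_even.mp hodd)] at this
      simpa [ht, hodd] using this
  have hpos : ∀ t, pos (x t) = (v t, decide (Odd t)) := by
    intro t
    induction t with
    | zero => simpa [x, hv.1] using hm₀
    | succ t ih => exact (hmove t ih).2
  have := hG.wins x fun t => (hmove t (hpos t)).1
  simpa only [hpos] using this

/-! ### Repeating a loop -/

/-- The sequence of times that repeats the loop from `x` to `y` forever. -/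
def loopTime (x y n : ℕ) : ℕ := if n < x then n else x + (n - x) % (y - x)

theorem loopTime_zero {x y : ℕ} : loopTime x y 0 = 0 := by
  unfold loopTime
  split_ifs <;> simp_all

theorem loopTime_lt {x y : ℕ} (hxy : x < y) (n : ℕ) : loopTime x y n < y := by
  unfold loopTime
  have := Nat.mod_lt (n - x) (Nat.sub_pos_of_lt hxy)
  split_ifs <;> omega

theorem loopTime_succ {x y : ℕ} (hxy : x < y) (n : ℕ) :
    loopTime x y (n + 1) = loopTime x y n + 1 ∨
      loopTime x y n + 1 = y ∧ loopTime x y (n + 1) = x := by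
  unfold loopTime
  by_cases h : n + 1 < x
  · simp [h, show n < x by omega]
  · by_cases h' : n < x
    · simp [h', h, show n + 1 - x = 0 by omega]
      omega
    · have hlt := Nat.mod_lt (n - x) (Nat.sub_pos_of_lt hxy)
      rw [if_neg h, if_neg h', show n + 1 - x = n - x + 1 by omega, Nat.add_mod_eq_ite]
      rcases Nat.lt_or_ge 1 (y - x) with h1 | h1
      · rw [Nat.mod_eq_of_lt h1]
        split_ifs <;> omega
      · rw [show y - x = 1 by omega] at hlt ⊢
        simp only [Nat.mod_one]
        split_ifs <;> omega

/-- A loop at `x` and `y` whose maximal priority is even, repeated forever, is won by Anke. -/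
theorem evenLimsup_loopTime {a : ℕ → ℕ} {x y : ℕ} (hxy : x < y) (haxy : a x = a y)
    (heven : Even (maxIco a x (y + 1))) : EvenLimsup fun n => a (loopTime x y n) := by
  rw [maxIco_succ a hxy.le, max_eq_left] at heven
  · refine ⟨_, heven, ?_, ?_⟩
    · obtain ⟨z, hz, hmax⟩ := Finset.exists_mem_eq_sup (Finset.Ico x y) ⟨x, by simp [hxy]⟩ a
      rw [Finset.mem_Ico] at hz
      rw [frequently_atTop]
      refine fun n => ⟨z + n * (y - x), ?_, ?_⟩
      · nlinarith [Nat.sub_pos_of_lt hxy]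
      · change a (loopTime x y (z + n * (y - x))) = maxIco a x y
        rw [maxIco, hmax, loopTime, if_neg (by omega), Nat.sub_add_comm hz.1,
          Nat.add_mul_mod_self_right, Nat.mod_eq_of_lt (by omega)]
        congr 1
        omega
    · refine eventually_atTop.mpr ⟨x, fun n hn => ?_⟩
      refine Finset.le_sup (f := a) (Finset.mem_Ico.mpr ⟨?_, loopTime_lt hxy n⟩)
      rw [loopTime, if_neg (by omega)]
      exact Nat.le_add_right _ _
  · rw [← haxy]
    exact Finset.le_sup (f := a) (Finset.mem_Ico.mpr ⟨le_rfl, hxy⟩)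

/-! ### Equivalence of the two games -/

/-- Against a winning positional strategy of Boris, Anke does not win the statistics game: of the
`2 ^ k` times two have the same position, and then Boris's strategy admits a loop with an even
maximal priority. -/
theorem not_borisWinsFrom_of_ankeWinsStatisticsGame [Fintype V] {k : ℕ}
    (hk : 2 * Fintype.card V < 2 ^ k) (h : G.AnkeWinsStatisticsGame k) :
    ¬ BorisWinsFrom (borisPositions V) (fun p => G.val p.1) G.successors (G.start, false) := by
  classical
  rintro ⟨τ, hτ, hwin⟩
  obtain ⟨σ, hσ⟩ := h
  obtain ⟨v, hv0, hv⟩ := exists_seq_of_rule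
    (fun h w => if Even h.length then σ.next h w else (τ (w, true)).1) G.start
  simp only [List.length_map, List.length_range] at hv
  have hboris : ∀ t, Odd t → (v (t + 1), false) = τ (v t, true) := by
    intro t ht
    rw [hv, if_neg (Nat.not_even_iff_odd.mpr ht)]
    exact Prod.ext rfl (G.mem_successors.mp (hτ (v t, true))).2.symm
  have hplay : G.IsPlay v := by
    refine ⟨hv0, fun t => ?_⟩
    rw [hv]
    split_ifs
    · exact σ.valid _ _
    · exact (G.mem_successors.mp (hτ (v t, true))).1
  obtain ⟨t, ht⟩ := hσ v hplay fun t ht => by rw [hv, if_pos ht]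
  obtain ⟨S, hS, heven⟩ := PriorityMap.exists_times_of_last_mem (a := fun t => G.val (v t))
    (f := fun t => (G.statistic k v t).1) (G.statistic_zero k v) (G.statistic_succ k v) ht
  let pos : ℕ → V × Bool := fun t => (v t, decide (Odd t))
  obtain ⟨x, hx, y, hy, hxy, hpos⟩ : ∃ x ∈ S, ∃ y ∈ S, x < y ∧ pos x = pos y := by
    obtain ⟨x, hx, y, hy, hne, hpos⟩ := Finset.exists_ne_map_eq_of_card_lt_of_maps_to
      (s := S) (t := Finset.univ) (f := pos)
      (by simpa [hS, mul_comm] using hk) (fun _ _ => by simp)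
    rcases lt_or_gt_of_ne hne with hlt | hlt
    · exact ⟨x, hx, y, hy, hlt, hpos⟩
    · exact ⟨y, hy, x, hx, hlt, hpos.symm⟩
  have hloop : ∀ n, pos (loopTime x y (n + 1)) = pos (loopTime x y n + 1) := by
    intro n
    rcases loopTime_succ hxy n with h | ⟨h, h'⟩
    · rw [h]
    · rw [h, h', hpos]
  refine hwin (fun n => pos (loopTime x y n)) ?_ (fun n => ?_) (fun n hn => ?_) ?_
  · simp [loopTime_zero, pos, hv0]
  · simp only [hloop, G.mem_successors]
    exact ⟨hplay.2 _, decide_odd_succ _⟩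
  · have hodd : Odd (loopTime x y n) := by simpa [pos, borisPositions] using hn
    simp only [hloop]
    simp only [pos, decide_odd_succ, hodd, decide_true, Bool.not_true]
    exact hboris _ hodd
  · exact evenLimsup_loopTime (a := fun t => G.val (v t)) hxy
      (congrArg G.val (congrArg Prod.fst hpos)) (heven x hx y hy hxy)

end ParityGame

theorem theorem1 {V : Type*} [Fintype V] (G : ParityGame V) (k : ℕ)
    (hk : 2 * Fintype.card V < 2 ^ k) :
    G.AnkeWinsParityGame ↔ G.AnkeWinsStatisticsGame k := by
  constructor
  · rintro ⟨σ, hσ⟩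
    exact ⟨σ, fun v hv hfol => PriorityMap.exists_last_mem_of_evenLimsup
      ((G.ankeWinsPlay_iff v).mp (hσ v hv hfol)) (G.statistic_succ k v)⟩
  · intro h
    exact G.ankeWinsParityGame_of_ankeWinsFrom ((borisWinsFrom_or_ankeWinsFrom
      G.successors_nonempty (G.start, false)).resolve_left
      (G.not_borisWinsFrom_of_ankeWinsStatisticsGame hk h))
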